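/- Let $N\ge 3$, $\alpha\ge 1$, $\beta\ge 1$, $\alpha\beta>1$, and let $p,q:\mathbb{R}^N\to[0,\infty)$ be continuous. For $r>0$ put $$\tilde p(r)=\begin{cases}\left(\dfrac{1}{\omega_N r^{N-1}}\displaystyle\int_{|x|=r}p(x)^{1/(1-\alpha)}\,dS\right)^{1-\alpha}, & \alpha>1,\\[2ex] \min_{|x|=r}p(x), & \alpha=1,\end{cases}\qquad \tilde q(r)=\begin{cases}\left(\dfrac{1}{\omega_N r^{N-1}}\displaystyle\int_{|x|=r}q(x)^{1/(1-\beta)}\,dS\right)^{1-\beta}, & \beta>1,\\[2ex] \min_{|x|=r}q(x), & \beta=1,\end{cases}$$ where $\omega_N$ is the surface area of the unit sphere in $\mathbb{R}^N$, a negative power of $0$ is read as $+\infty$, and $\tilde p(r)=0$ (respectively $\tilde q(r)=0$) if the corresponding integral is infinite. Suppose that there are real constants $\lambda,\mu,\nu,\xi$, $L_1>0$, $L_2>0$ and $r_0>1$ such that $$\tilde p(r)\ge\frac{L_1}{r^{\lambda}\ln^{\nu}r},\qquad \tilde q(r)\ge\frac{L_2}{r^{\mu}\ln^{\xi}r}\qquad\text{for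 all } r\ge r_0.$$ Suppose also that at least one of the following conditions holds: (i) $2-\mu+\beta(2-\lambda)>0$; (ii) $2-\lambda+\alpha(2-\mu)>0$; (iii) $2-\mu+\beta(2-\lambda)=0$, $\lambda<2$ and $1-\xi-\beta\nu>0$; (iv) $2-\lambda+\alpha(2-\mu)=0$, $\mu<2$ and $1-\nu-\alpha\xi>0$; (v) $\lambda=2$, $\mu=2$ and $1-\xi+\beta(1-\nu)>0$; (vi) $\lambda=2$, $\mu=2$ and $1-\nu+\alpha(1-\xi)>0$. Then the system $$\Delta u=p(x)\,v^{\alpha},\qquad \Delta v=q(x)\,u^{\beta}$$ has no nontrivial nonnegative entire solution; that is, if $u,v\in C^2(\mathbb{R}^N)$ are nonnegative and satisfy both equations at every point of $\mathbb{R}^N$, then $u\equiv 0$ and $v\equiv 0$. -/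

import Mathlib

open MeasureTheory Metric
open scoped ENNReal

noncomputable section

/-- The surface measure `dS` on the sphere `|x| = r` in `ℝ^N`, regarded as a measure on `ℝ^N`:
the image of the surface measure of the unit sphere under `ω ↦ r ω`, scaled by `r ^ (N - 1)`.
(`Measure.toSphere volume` is the surface measure of the unit sphere, of total mass
`N * vol (ball 0 1)`.) It is used for `r > 0`, `N ≥ 3`. -/
def surfaceMeasure (N : ℕ) (r : ℝ) : Measure (EuclideanSpace ℝ (Fin N)) :=
  ENNReal.ofReal (r ^ (N - 1)) •
    Measure.map (fun ω : sphere (0 : EuclideanSpace ℝ (Fin N)) 1 =>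
        r • (ω : EuclideanSpace ℝ (Fin N)))
      (volume : Measure (EuclideanSpace ℝ (Fin N))).toSphere

/-- `ω_N`, the surface area of the unit sphere in `ℝ^N`. -/
def unitSphereArea (N : ℕ) : ℝ≥0∞ :=
  (volume : Measure (EuclideanSpace ℝ (Fin N))).toSphere Set.univ

/-- The spherical average of a nonnegative continuous coefficient `p` with exponent `α ≥ 1`.
* For `α > 1` it is `(1 / (ω_N r^(N-1)) ∫_{|x| = r} p^(1/(1-α)) dS)^(1-α)`. The computation is done
  in `[0, ∞]`, where `0^(1/(1-α)) = ∞` and `∞^(1-α) = 0`; hence the value is `0` exactly when the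
  integral is infinite. For continuous `p` and `r > 0` the integral is never zero, so
  the value is finite and `toReal` loses nothing.
* For `α = 1` it is `min_{|x| = r} p(x)` (the minimum is attained, by compactness). -/
def sphericalAverage {N : ℕ} (α : ℝ) (p : EuclideanSpace ℝ (Fin N) → ℝ) (r : ℝ) : ℝ :=
  if 1 < α then
    (((∫⁻ x, ENNReal.ofReal (p x) ^ (1 / (1 - α)) ∂(surfaceMeasure N r)) /
      (unitSphereArea N * ENNReal.ofReal (r ^ (N - 1)))) ^ (1 - α)).toReal
  else
    sInf (p '' sphere (0 : EuclideanSpace ℝ (Fin N)) r)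

/-- `(u, v)` is an entire solution of `Δu = p v^α`, `Δv = q u^β`: both functions are `C²` on `ℝ^N`
and the equations hold at every point. (Only used together with `u ≥ 0`, `v ≥ 0`.) -/
structure IsEntireSolution {N : ℕ} (α β : ℝ) (p q : EuclideanSpace ℝ (Fin N) → ℝ)
    (u v : EuclideanSpace ℝ (Fin N) → ℝ) : Prop where
  contDiff_left : ContDiff ℝ 2 u
  contDiff_right : ContDiff ℝ 2 v
  eq_left : ∀ x, Laplacian.laplacian u x = p x * v x ^ α
  eq_right : ∀ x, Laplacian.laplacian v x = q x * u x ^ β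

end

/-! Averaging over spheres reduces the system to ordinary differential inequalities whose solutions
would blow up at a finite radius. Let `A(t)` and `B(t)` be the means of `u` and `v` over `|x| =
e^t`, and let `m = N - 2`. The divergence theorem expresses `A'' + m A'` as `e^{2t}` times the mean
of `Δu = p v^α`, and Hölder's inequality bounds that mean below by `p̃ B^α`. Thus `A` and `B` are
nondecreasing and, for large `t`, `A'' + m A' ≥ L₁ e^{(2-λ)t} t^{-ν} B^α` and `B'' + m B' ≥ L₂
e^{(2-μ)t} t^{-ξ} A^β` (`isDampedSupersolution_sphereMean`). Applying the elementary growth estimate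
`IsDampedSupersolution.step` first to `A`, then to `B`, gives for `s ∈ [s₀, 3s₀]` and small `ε` `B(s
+ 2εs₀) ≥ C K(s₀) ε^{2+2β} B(s)^{αβ}`, where the conditions on the exponents are what makes `K(s₀) →
∞` (`superlinear_step`, `superlinear_step_of_two`). Since `αβ > 1`, iterating with `ε` halved each
time makes `B` unbounded before `3s₀` (`false_of_superlinear_growth`). Half of the six conditions
follow by exchanging `u` and `v`. -/

open Filter Topology

/-! ### Growth of damped supersolutions. -/

/-- `y` is nondecreasing and satisfies `y'' + m y' ≥ k` on `[T, ∞)`, in the form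
`(e^{mt} y')' ≥ e^{mt} k`. -/
def IsDampedSupersolution (m T : ℝ) (y k : ℝ → ℝ) : Prop :=
  ∃ y' F : ℝ → ℝ, (∀ t, HasDerivAt y (y' t) t) ∧ (∀ t, 0 ≤ y' t) ∧
    ∀ t, T ≤ t → HasDerivAt (fun τ => Real.exp (m * τ) * y' τ) (F t) t ∧
      Real.exp (m * t) * k t ≤ F t

namespace IsDampedSupersolution

variable {m T : ℝ} {y k : ℝ → ℝ}

theorem monotone (h : IsDampedSupersolution m T y k) : Monotone y := by
  obtain ⟨y', F, hy, hy0, -⟩ := h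
  exact monotone_of_hasDerivAt_nonneg hy hy0

/-- Integrating `(e^{mt} y')' ≥ c e^{mt}` from `s` gives `y'(t) ≥ (c/m)(1 - e^{-m(t-s)})`. On the
second half of the interval this is at least `ch/(2+mh)`, because `e^{mh/2} ≥ 1 + mh/2`; integrating
over that half gives the gain. -/
theorem step (H : IsDampedSupersolution m T y k) (hm : 0 < m) {s h c : ℝ} (hs : T ≤ s)
    (hh : 0 < h) (hc : 0 ≤ c) (hk : ∀ σ, s ≤ σ → σ ≤ s + h → c ≤ k σ) :
    y s + c * h ^ 2 / (4 + 2 * m * h) ≤ y (s + h) := by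
  have hmono := H.monotone
  obtain ⟨y', F, hy, hy0, hF⟩ := H
  have hE : ∀ t, HasDerivAt (fun τ => Real.exp (m * τ)) (Real.exp (m * t) * m) t := fun t => by
    simpa using ((hasDerivAt_id t).const_mul m).exp
  have hg : ∀ t, T ≤ t → HasDerivAt
      (fun τ => Real.exp (m * τ) * y' τ - c / m * Real.exp (m * τ))
      (F t - c / m * (Real.exp (m * t) * m)) t :=
    fun t ht => (hF t ht).1.sub ((hE t).const_mul _)
  have hgm : MonotoneOn (fun τ => Real.exp (m * τ) * y' τ - c / m * Real.exp (m * τ))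
      (Set.Icc s (s + h)) := by
    refine monotoneOn_of_deriv_nonneg (convex_Icc _ _)
      (fun t ht => (hg t (hs.trans ht.1)).continuousAt.continuousWithinAt)
      (fun t ht => (hg t (hs.trans (interior_subset ht).1)).differentiableAt.differentiableWithinAt)
      fun t ht => ?_
    have ht' := interior_subset ht
    rw [(hg t (hs.trans ht'.1)).deriv]
    have h1 := (hF t (hs.trans ht'.1)).2
    have h2 := mul_le_mul_of_nonneg_left (hk t ht'.1 ht'.2) (Real.exp_pos (m * t)).le
    have h3 : c / m * (Real.exp (m * t) * m) = Real.exp (m * t) * c := by field_simp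
    linarith
  have hD : 0 < 2 + m * h := by positivity
  have hlow : ∀ t, s + h / 2 ≤ t → t ≤ s + h → c * h / (2 + m * h) ≤ y' t := by
    intro t ht1 ht2
    have h1 := hgm ⟨le_rfl, by linarith⟩ ⟨by linarith, ht2⟩ (by linarith : s ≤ t)
    have h1 : Real.exp (m * s) * y' s - c / m * Real.exp (m * s) ≤
      Real.exp (m * t) * y' t - c / m * Real.exp (m * t) := h1
    have h2 := mul_nonneg (Real.exp_pos (m * s)).le (hy0 s)
    have h3 : Real.exp (m * t) = Real.exp (m * s) * Real.exp (m * (t - s)) := by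
      rw [← Real.exp_add]; ring_nf
    have h4 : 1 + m * h / 2 ≤ Real.exp (m * (t - s)) := by
      have := Real.add_one_le_exp (m * (t - s))
      nlinarith
    have hcm : 0 ≤ c / m := by positivity
    have h5 : c / m * (Real.exp (m * (t - s)) - 1) ≤ Real.exp (m * (t - s)) * y' t := by
      have : 0 ≤ Real.exp (m * s) * (Real.exp (m * (t - s)) * y' t -
          c / m * (Real.exp (m * (t - s)) - 1)) := by
        rw [h3] at h1; nlinarith
      have := nonneg_of_mul_nonneg_right this (Real.exp_pos _)
      linarith
    set X := Real.exp (m * (t - s)) with hX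
    have hX0 : 0 < X := Real.exp_pos _
    have h6 : c * h / (2 + m * h) * X ≤ c / m * (X - 1) := by
      have : c / m * (X - 1) - c * h / (2 + m * h) * X =
          c * (2 * (X - (1 + m * h / 2))) / (m * (2 + m * h)) := by
        field_simp; ring
      have h7 : 0 ≤ c * (2 * (X - (1 + m * h / 2))) / (m * (2 + m * h)) :=
        div_nonneg (mul_nonneg hc (by linarith)) (by positivity)
      linarith
    nlinarith [mul_comm X (y' t)]
  have hlin : MonotoneOn (fun t => y t - c * h / (2 + m * h) * t) (Set.Icc (s + h / 2) (s + h)) := by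
    have hd : ∀ t, HasDerivAt (fun t => y t - c * h / (2 + m * h) * t)
        (y' t - c * h / (2 + m * h)) t := fun t => by
      have := (hy t).sub ((hasDerivAt_id t).const_mul (c * h / (2 + m * h)))
      rw [mul_one] at this
      exact this
    refine monotoneOn_of_deriv_nonneg (convex_Icc _ _)
      (fun t _ => (hd t).continuousAt.continuousWithinAt)
      (fun t _ => (hd t).differentiableAt.differentiableWithinAt) fun t ht => ?_
    have ht' := interior_subset ht
    rw [(hd t).deriv]
    linarith [hlow t ht'.1 ht'.2]
  have h1 : y (s + h / 2) - c * h / (2 + m * h) * (s + h / 2) ≤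
      y (s + h) - c * h / (2 + m * h) * (s + h) :=
    hlin ⟨le_rfl, by linarith⟩ ⟨by linarith, le_rfl⟩ (by linarith)
  have h2 : y s ≤ y (s + h / 2) := hmono (by linarith)
  have h3 : c * h ^ 2 / (4 + 2 * m * h) = c * h / (2 + m * h) * (h / 2) := by
    field_simp; ring
  rw [h3]; linarith

/-- Damping makes the gain over a long interval linear, not quadratic, in its length. The factor
`ε²` is a uniform price for short steps. -/
theorem step_scaled (H : IsDampedSupersolution m T y k) (hm : 0 < m) (hy0 : ∀ t, 0 ≤ y t)
    {s ε ρ c : ℝ} (hs : T ≤ s) (hε : 0 < ε) (hε1 : ε ≤ 1) (hρ : 1 ≤ ρ) (hc : 0 ≤ c)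
    (hk : ∀ σ, s ≤ σ → σ ≤ s + ε * ρ → c ≤ k σ) :
    c * ε ^ 2 * ρ / (4 + 2 * m) ≤ y (s + ε * ρ) := by
  have h1 := H.step hm hs (by positivity : 0 < ε * ρ) hc hk
  have h2 : c * ε ^ 2 * ρ / (4 + 2 * m) ≤ c * (ε * ρ) ^ 2 / (4 + 2 * m * (ε * ρ)) := by
    rw [div_le_div_iff₀ (by positivity) (by positivity)]
    have h3 : 4 + 2 * m * (ε * ρ) ≤ ρ * (4 + 2 * m) := by
      have : ε * ρ ≤ ρ := by nlinarith
      nlinarith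
    have h4 : 0 ≤ c * ε ^ 2 * ρ := by positivity
    calc c * ε ^ 2 * ρ * (4 + 2 * m * (ε * ρ)) ≤ c * ε ^ 2 * ρ * (ρ * (4 + 2 * m)) :=
          mul_le_mul_of_nonneg_left h3 h4
      _ = c * (ε * ρ) ^ 2 * (4 + 2 * m) := by ring
  linarith [hy0 s]

end IsDampedSupersolution

/-! ### Finite-time blow-up of a superlinear iteration. -/

theorem false_of_superlinear_growth {B K : ℝ → ℝ} {S c γ k : ℝ} (hS : 0 < S) (hc : 0 < c)
    (hγ : 1 < γ) (hk : 0 < k) (hB : ∀ s, S ≤ s → c ≤ B s)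
    (hmono : Monotone B) (hK : Tendsto K atTop atTop)
    (hstep : ∀ s₀ s ε, S ≤ s₀ → s₀ ≤ s → 0 < ε → ε ≤ 1 → s + 2 * ε * s₀ ≤ 3 * s₀ →
      K s₀ * ε ^ k * B s ^ γ ≤ B (s + 2 * ε * s₀)) : False := by
  -- Chosen so that `M^γ = M · 2^k`: the superlinear power then exactly compensates the loss `ε^k`
  -- when `ε` is halved at each step.
  set M : ℝ := 2 ^ (k / (γ - 1)) with hM
  have hγ' : 0 < γ - 1 := by linarith
  have hM1 : 1 < M := Real.one_lt_rpow (by norm_num) (by positivity)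
  have hM0 : 0 < M := by linarith
  have hMγ : M ^ γ = M * 2 ^ k := by
    have : M ^ (γ - 1) = 2 ^ k := by
      rw [hM, ← Real.rpow_mul (by norm_num)]; congr 1; field_simp
    rw [← this, ← Real.rpow_one_add' hM0.le (by linarith)]; congr 1; ring
  obtain ⟨s₀, hs₀K, hs₀S⟩ :=
    ((hK.eventually_ge_atTop (c ^ (1 - γ) * 2 ^ k * M)).and (eventually_ge_atTop S)).exists
  have hs₀ : 0 < s₀ := by linarith
  have hK0 : 0 ≤ K s₀ := le_trans (by positivity) hs₀K
  -- The points increase from `s₀` towards `3s₀`, with steps `2εs₀` for `ε = 2^{-(n+1)}`. The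
  -- induction closes because `K s₀ ≥ c^{1-γ} 2^k M`.
  have key : ∀ n : ℕ, c * M ^ n ≤ B (3 * s₀ - 2 * s₀ * (1 / 2) ^ n) := by
    intro n
    induction n with
    | zero => simpa using hB _ (by linarith)
    | succ n ih =>
      have hp : (0 : ℝ) < (1 / 2) ^ n := by positivity
      have hp1 : ((1 : ℝ) / 2) ^ n ≤ 1 := pow_le_one₀ (by norm_num) (by norm_num)
      have h1 := hstep s₀ (3 * s₀ - 2 * s₀ * (1 / 2) ^ n) ((1 / 2) ^ (n + 1)) hs₀S
        (by nlinarith) (by positivity) (pow_le_one₀ (by norm_num) (by norm_num))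
        (by rw [pow_succ]; nlinarith)
      have h2 : 3 * s₀ - 2 * s₀ * (1 / 2) ^ n + 2 * (1 / 2) ^ (n + 1) * s₀ =
          3 * s₀ - 2 * s₀ * (1 / 2) ^ (n + 1) := by rw [pow_succ]; ring
      rw [h2] at h1
      refine le_trans ?_ h1
      have h3 : (c * M ^ n) ^ γ ≤ B (3 * s₀ - 2 * s₀ * (1 / 2) ^ n) ^ γ :=
        Real.rpow_le_rpow (by positivity) ih (by linarith)
      have h4 : (c * M ^ n) ^ γ = c ^ γ * (M ^ n * (2 ^ k) ^ n) := by
        rw [Real.mul_rpow hc.le (by positivity), ← Real.rpow_natCast M n, ← Real.rpow_mul hM0.le,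
          mul_comm (n : ℝ) γ, Real.rpow_mul hM0.le, hMγ, Real.rpow_natCast, mul_pow,
          Real.rpow_natCast]
      have h5 : (((1 : ℝ) / 2) ^ (n + 1)) ^ k = ((2 ^ k) ^ (n + 1))⁻¹ := by
        rw [one_div, inv_pow, Real.inv_rpow (by positivity), ← Real.rpow_natCast 2,
          ← Real.rpow_mul (by norm_num), mul_comm, Real.rpow_mul (by norm_num), Real.rpow_natCast]
      have h6 : c ^ (1 - γ) * c ^ γ = c := by
        rw [← Real.rpow_add hc]; simp
      calc c * M ^ (n + 1)
          = (c ^ (1 - γ) * 2 ^ k * M) * ((2 ^ k) ^ (n + 1))⁻¹ * (c ^ γ * (M ^ n * (2 ^ k) ^ n)) := by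
            have : (0 : ℝ) < 2 ^ k := by positivity
            rw [pow_succ (2 ^ k : ℝ) n]
            field_simp
            rw [pow_succ]
            linear_combination (-(M ^ n * M)) * h6
        _ ≤ K s₀ * ((2 ^ k) ^ (n + 1))⁻¹ * (c ^ γ * (M ^ n * (2 ^ k) ^ n)) := by gcongr
        _ ≤ _ := by
          rw [← h4, h5]
          gcongr
  have hlim : Tendsto (fun n : ℕ => c * M ^ n) atTop atTop :=
    (tendsto_pow_atTop_atTop_of_one_lt hM1).const_mul_atTop hc
  obtain ⟨n, hn⟩ := (hlim.eventually_gt_atTop (B (3 * s₀))).exists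
  have h1 := key n
  have h2 : B (3 * s₀ - 2 * s₀ * (1 / 2) ^ n) ≤ B (3 * s₀) := hmono (by
    have : (0 : ℝ) < (1 / 2) ^ n := by positivity
    nlinarith)
  linarith

/-! ### The weights, and propagation of positivity from `A` to `B`. -/

theorem rpow_comparable {x y : ℝ} (hx : 0 < x) (hy : 0 < y) (hxy : x ≤ 3 * y) (hyx : y ≤ 3 * x)
    (κ : ℝ) : 3 ^ (-|κ|) * x ^ κ ≤ y ^ κ := by
  rcases le_total 0 κ with h | h
  · rw [abs_of_nonneg h, Real.rpow_neg (by norm_num), inv_mul_le_iff₀ (by positivity),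
      ← Real.mul_rpow (by norm_num) hy.le]
    exact Real.rpow_le_rpow hx.le hxy h
  · rw [abs_of_nonpos h, neg_neg, ← Real.mul_rpow (by norm_num) hx.le]
    exact Real.rpow_le_rpow_of_nonpos hy hyx h

/-- The weight `L e^{(2-λ)t} t^{-ν}`, i.e. `r² · L r^{-λ} (log r)^{-ν}` at `r = e^t`. -/
noncomputable def expWeight (L lam nu t : ℝ) : ℝ := L * Real.exp ((2 - lam) * t) * t ^ (-nu)

theorem expWeight_pos {L t : ℝ} (hL : 0 < L) (ht : 0 < t) (lam nu : ℝ) :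
    0 < expWeight L lam nu t := by
  unfold expWeight; positivity

theorem expWeight_of_two (L nu t : ℝ) : expWeight L 2 nu t = L * t ^ (-nu) := by
  simp [expWeight]

theorem expWeight_le_of_sub_le_one {L s t : ℝ} (hL : 0 < L) (lam nu : ℝ) (hs : 1 ≤ s)
    (hst : s ≤ t) (hts : t ≤ s + 1) :
    3 ^ (-|nu|) * Real.exp (-|2 - lam|) * expWeight L lam nu t ≤ expWeight L lam nu s := by
  have h1 := rpow_comparable (by linarith : 0 < t) (by linarith : 0 < s) (by linarith)
    (by linarith) (-nu)
  rw [abs_neg] at h1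
  have h2 : Real.exp (-|2 - lam|) * Real.exp ((2 - lam) * t) ≤ Real.exp ((2 - lam) * s) := by
    rw [← Real.exp_add]
    apply Real.exp_le_exp.2
    nlinarith [abs_nonneg (2 - lam), le_abs_self (2 - lam), mul_le_mul_of_nonneg_right
      (le_abs_self (2 - lam)) (sub_nonneg.2 hst)]
  unfold expWeight
  have ht0 : 0 < t := by linarith
  calc _ = L * (Real.exp (-|2 - lam|) * Real.exp ((2 - lam) * t)) * (3 ^ (-|nu|) * t ^ (-nu)) := by
        ring
    _ ≤ _ := by gcongr

/-- The iteration runs on `B` alone, so it needs a positive starting value of `B` even when only `A`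
is known to be nontrivial. -/
theorem exists_pos_lower_bound {m T beta mu xi L : ℝ} {A B : ℝ → ℝ} (hm : 0 < m) (hT : 1 ≤ T)
    (hL : 0 < L) (hB0 : ∀ t, 0 ≤ B t) (hAc : Monotone A)
    (hB : IsDampedSupersolution m T B fun t => expWeight L mu xi t * A t ^ beta)
    (hβ : 0 ≤ beta) (hpos : ∃ t, 0 < A t) : ∃ t, 0 < B t := by
  obtain ⟨t₀, ht₀⟩ := hpos
  set s := max t₀ T
  have hs1 : 1 ≤ s := hT.trans (le_max_right _ _)
  set c := 3 ^ (-|-xi|) * (L * Real.exp (-(|2 - mu| * (s + 1))) * s ^ (-xi)) * A t₀ ^ beta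
  have hc : 0 < c := by positivity
  have h := hB.step hm (le_max_right t₀ T) one_pos hc.le fun σ h1 h2 => by
    have e1 : A t₀ ^ beta ≤ A σ ^ beta :=
      Real.rpow_le_rpow ht₀.le (hAc ((le_max_left _ _).trans h1)) hβ
    have e2 := rpow_comparable (by linarith : 0 < s) (by linarith : 0 < σ) (by linarith)
      (by linarith) (-xi)
    have e3 : Real.exp (-(|2 - mu| * (s + 1))) ≤ Real.exp ((2 - mu) * σ) := by
      apply Real.exp_le_exp.2
      nlinarith [abs_nonneg (2 - mu), neg_abs_le (2 - mu), mul_le_mul_of_nonneg_right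
        (neg_abs_le (2 - mu)) (by linarith : 0 ≤ σ)]
    show c ≤ expWeight L mu xi σ * A σ ^ beta
    have hσ : 0 < σ := by linarith
    unfold expWeight
    calc c = L * Real.exp (-(|2 - mu| * (s + 1))) * (3 ^ (-|-xi|) * s ^ (-xi)) * A t₀ ^ beta := by
          ring
      _ ≤ _ := by gcongr
  refine ⟨s + 1, lt_of_lt_of_le ?_ h⟩
  have : 0 < c * 1 ^ 2 / (4 + 2 * m * 1) := by positivity
  linarith [hB0 s]

/-! ### One round of the coupled inequalities, and nonexistence for the averaged system. -/

section

variable {m T alpha beta lam mu nu xi L₁ L₂ : ℝ} {A B : ℝ → ℝ}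

/-- Without exponential factors both steps can have length `εs₀`. The step for `A` contributes
`s₀^{1-ν}`, which the coupling raises to the power `β`; the step for `B` contributes `s₀^{1-ξ}`. -/
theorem superlinear_step_of_two (hm : 0 < m) (hT : 1 ≤ T) (hL₁ : 0 < L₁) (hL₂ : 0 < L₂)
    (hα : 1 ≤ alpha) (hβ : 1 ≤ beta)
    (hA0 : ∀ t, 0 ≤ A t) (hB0 : ∀ t, 0 ≤ B t)
    (hA : IsDampedSupersolution m T A fun t => expWeight L₁ 2 nu t * B t ^ alpha)
    (hB : IsDampedSupersolution m T B fun t => expWeight L₂ 2 xi t * A t ^ beta) :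
    ∃ C, 0 < C ∧ ∀ s₀ s ε, T ≤ s₀ → s₀ ≤ s → 0 < ε → ε ≤ 1 → s + 2 * ε * s₀ ≤ 3 * s₀ →
      C * s₀ ^ (1 - xi + beta * (1 - nu)) * ε ^ (2 + 2 * beta) * B s ^ (alpha * beta) ≤
        B (s + 2 * ε * s₀) := by
  set D := L₁ * 3 ^ (-|-nu|) / (4 + 2 * m) with hD
  set C := L₂ * 3 ^ (-|-xi|) * D ^ beta / (4 + 2 * m) with hC
  have hD0 : 0 < D := by positivity
  refine ⟨C, by positivity, fun s₀ s ε hs₀ hs hε hε1 hend => ?_⟩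
  have hs0 : 0 < s₀ := by linarith
  have hεs : 0 < ε * s₀ := by positivity
  have hb := hB0 s
  have h1 := hA.step_scaled (c := L₁ * (3 ^ (-|-nu|) * s₀ ^ (-nu)) * B s ^ alpha)
    hm hA0 (by linarith : T ≤ s) hε hε1 (by linarith : 1 ≤ s₀) (by positivity)
    fun σ h1 h2 => by
      have e1 := Real.rpow_le_rpow hb (hB.monotone h1) (by linarith : 0 ≤ alpha)
      have e2 := rpow_comparable hs0 (by linarith : 0 < σ) (by linarith) (by linarith) (-nu)
      rw [expWeight_of_two]
      have hσ : 0 < σ := by linarith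
      gcongr
  set a := L₁ * (3 ^ (-|-nu|) * s₀ ^ (-nu)) * B s ^ alpha * ε ^ 2 * s₀ / (4 + 2 * m) with ha
  have ha0 : 0 ≤ a := by positivity
  have h2 := hB.step_scaled (s := s + ε * s₀) (c := L₂ * (3 ^ (-|-xi|) * s₀ ^ (-xi)) * a ^ beta)
    hm hB0 (by linarith : T ≤ s + ε * s₀) hε hε1 (by linarith : 1 ≤ s₀) (by positivity)
    fun σ h3 h4 => by
      have e1 := Real.rpow_le_rpow ha0 (h1.trans (hA.monotone h3)) (by linarith : 0 ≤ beta)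
      have e2 := rpow_comparable hs0 (by linarith : 0 < σ) (by linarith) (by linarith) (-xi)
      rw [expWeight_of_two]
      have hσ : 0 < σ := by linarith
      gcongr
  have e : s + 2 * ε * s₀ = s + ε * s₀ + ε * s₀ := by ring
  rw [e]
  refine le_trans (le_of_eq ?_) h2
  have ea : a = D * s₀ ^ (1 - nu) * ε ^ (2 : ℝ) * B s ^ alpha := by
    rw [ha, hD, sub_eq_add_neg, Real.rpow_add hs0, Real.rpow_one, Real.rpow_two]; ring
  rw [ea, Real.mul_rpow (by positivity) (by positivity),
    Real.mul_rpow (by positivity) (by positivity),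
    Real.mul_rpow (by positivity) (by positivity), ← Real.rpow_mul hb, ← Real.rpow_mul hs0.le,
    ← Real.rpow_mul hε.le, hC, Real.rpow_add hs0, Real.rpow_add hε, Real.rpow_two,
    sub_eq_add_neg 1 xi, Real.rpow_add hs0, Real.rpow_one, mul_comm beta (1 - nu)]
  ring

/-- Here `A` is bounded just before each `σ`, by a step of length only `ε`, so that its exponential
weight is kept at `σ` itself. Only after the two weights combine into `e^{θσ} σ^{-(ξ+βν)}`, with `θ
= 2 - μ + β(2 - λ) ≥ 0`, is the exponential replaced by its value at `s₀`. The step for `B` has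
length `εs₀` and supplies the extra factor `s₀`. -/
theorem superlinear_step (hm : 0 < m) (hT : 1 ≤ T) (hL₁ : 0 < L₁) (hL₂ : 0 < L₂)
    (hα : 1 ≤ alpha) (hβ : 1 ≤ beta)
    (hA0 : ∀ t, 0 ≤ A t) (hB0 : ∀ t, 0 ≤ B t)
    (hA : IsDampedSupersolution m T A fun t => expWeight L₁ lam nu t * B t ^ alpha)
    (hB : IsDampedSupersolution m T B fun t => expWeight L₂ mu xi t * A t ^ beta)
    (hθ : 0 ≤ 2 - mu + beta * (2 - lam)) :
    ∃ C, 0 < C ∧ ∀ s₀ s ε, T ≤ s₀ → s₀ ≤ s → 0 < ε → ε ≤ 1 → s + 2 * ε * s₀ ≤ 3 * s₀ →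
      C * (s₀ ^ (1 - xi - beta * nu) * Real.exp ((2 - mu + beta * (2 - lam)) * s₀)) *
        ε ^ (2 + 2 * beta) * B s ^ (alpha * beta) ≤ B (s + 2 * ε * s₀) := by
  set D := 3 ^ (-|nu|) * Real.exp (-|2 - lam|) * L₁ / (4 + 2 * m) with hD
  set C := L₂ * 3 ^ (-|-(xi + beta * nu)|) * D ^ beta / (4 + 2 * m) with hC
  have hD0 : 0 < D := by positivity
  refine ⟨C, by positivity, fun s₀ s ε hs₀ hs hε hε1 hend => ?_⟩
  have hs0 : 0 < s₀ := by linarith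
  have hεs : 0 < ε * s₀ := by positivity
  have hεs' : ε ≤ ε * s₀ := by nlinarith
  have hb := hB0 s
  have h1 : ∀ σ, s + ε ≤ σ →
      D * Real.exp ((2 - lam) * σ) * σ ^ (-nu) * ε ^ (2 : ℝ) * B s ^ alpha ≤ A σ := by
    intro σ hσ
    have hσ0 : 0 < σ := by linarith
    have h := hA.step_scaled (s := σ - ε) (ρ := 1)
      (c := 3 ^ (-|nu|) * Real.exp (-|2 - lam|) * expWeight L₁ lam nu σ * B s ^ alpha)
      hm hA0 (by linarith) hε hε1 le_rfl
      (by have := expWeight_pos hL₁ hσ0 lam nu; positivity)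
      fun τ h1 h2 => by
        have e1 := Real.rpow_le_rpow hb (hB.monotone (by linarith : s ≤ τ))
          (by linarith : 0 ≤ alpha)
        have e2 := expWeight_le_of_sub_le_one hL₁ lam nu (by linarith : 1 ≤ τ)
          (by linarith : τ ≤ σ) (by linarith)
        have := (expWeight_pos hL₁ (by linarith : 0 < τ) lam nu).le
        gcongr
    rw [show σ - ε + ε * 1 = σ by ring] at h
    refine le_trans (le_of_eq ?_) h
    rw [hD, expWeight, Real.rpow_two]; ring
  have h2 := hB.step_scaled (s := s + ε)
    (c := L₂ * D ^ beta * (3 ^ (-|-(xi + beta * nu)|) * s₀ ^ (-(xi + beta * nu))) *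
      Real.exp ((2 - mu + beta * (2 - lam)) * s₀) * ε ^ (2 * beta) * B s ^ (alpha * beta))
    hm hB0 (by linarith : T ≤ s + ε) hε hε1 (by linarith : 1 ≤ s₀) (by positivity)
    fun σ h3 h4 => by
      have hσ : 0 < σ := by linarith
      have e1 := Real.rpow_le_rpow (by positivity) (h1 σ h3) (by linarith : 0 ≤ beta)
      have e2 := rpow_comparable hs0 hσ (by linarith) (by linarith) (-(xi + beta * nu))
      have e3 : Real.exp ((2 - mu + beta * (2 - lam)) * s₀) ≤
          Real.exp ((2 - mu + beta * (2 - lam)) * σ) :=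
        Real.exp_le_exp.2 (mul_le_mul_of_nonneg_left (by linarith) hθ)
      have hw := (expWeight_pos hL₂ hσ mu xi).le
      refine le_trans ?_ (mul_le_mul_of_nonneg_left e1 hw)
      rw [Real.mul_rpow (by positivity) (by positivity),
        Real.mul_rpow (by positivity) (by positivity),
        Real.mul_rpow (by positivity) (by positivity),
        Real.mul_rpow (by positivity) (by positivity), ← Real.rpow_mul hb, ← Real.rpow_mul hσ.le,
        ← Real.rpow_mul hε.le, ← Real.exp_mul, expWeight]
      calc _ ≤ L₂ * D ^ beta * σ ^ (-(xi + beta * nu)) *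
            Real.exp ((2 - mu + beta * (2 - lam)) * σ) * ε ^ (2 * beta) *
              B s ^ (alpha * beta) := by gcongr
        _ = _ := by
          have e4 : -(xi + beta * nu) = -xi + -nu * beta := by ring
          have e5 : (2 - mu + beta * (2 - lam)) * σ = (2 - mu) * σ + (2 - lam) * σ * beta := by
            ring
          rw [e4, e5, Real.rpow_add hσ, Real.exp_add]; ring
  -- The two steps end at `s + ε + εs₀`, which is at most `s + 2εs₀` since `s₀ ≥ 1`.
  refine le_trans (le_of_eq ?_) (h2.trans (hB.monotone (by linarith)))
  rw [hC, Real.rpow_add hε, Real.rpow_two, (by ring : 1 - xi - beta * nu = 1 + -(xi + beta * nu)),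
    Real.rpow_add hs0, Real.rpow_one]
  ring

theorem false_of_damped_system (hm : 0 < m) (hT : 1 ≤ T) (hL₁ : 0 < L₁) (hL₂ : 0 < L₂)
    (hα : 1 ≤ alpha) (hβ : 1 ≤ beta) (hαβ : 1 < alpha * beta)
    (hA0 : ∀ t, 0 ≤ A t) (hB0 : ∀ t, 0 ≤ B t)
    (hA : IsDampedSupersolution m T A fun t => expWeight L₁ lam nu t * B t ^ alpha)
    (hB : IsDampedSupersolution m T B fun t => expWeight L₂ mu xi t * A t ^ beta)
    (hpos : ∃ t, 0 < A t ∨ 0 < B t)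
    (hcond : 0 < 2 - mu + beta * (2 - lam) ∨
      (2 - mu + beta * (2 - lam) = 0 ∧ 0 < 1 - xi - beta * nu) ∨
      (lam = 2 ∧ mu = 2 ∧ 0 < 1 - xi + beta * (1 - nu))) : False := by
  have hBpos : ∃ t, 0 < B t := by
    obtain ⟨t, h | h⟩ := hpos
    · exact exists_pos_lower_bound hm hT hL₂ hB0 hA.monotone hB (by linarith) ⟨t, h⟩
    · exact ⟨t, h⟩
  obtain ⟨t₀, ht₀⟩ := hBpos
  have finish : ∀ K : ℝ → ℝ, Tendsto K atTop atTop → (∃ C, 0 < C ∧ ∀ s₀ s ε, T ≤ s₀ → s₀ ≤ s →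
      0 < ε → ε ≤ 1 → s + 2 * ε * s₀ ≤ 3 * s₀ →
      C * K s₀ * ε ^ (2 + 2 * beta) * B s ^ (alpha * beta) ≤ B (s + 2 * ε * s₀)) → False := by
    rintro K hK ⟨C, hC, hstep⟩
    exact false_of_superlinear_growth (S := max t₀ T) (lt_of_lt_of_le (by linarith)
      (le_max_right _ _)) ht₀ hαβ (by linarith : 0 < 2 + 2 * beta)
      (fun s hs => hB.monotone ((le_max_left _ _).trans hs)) hB.monotone
      (hK.const_mul_atTop hC) fun s₀ s ε h => hstep s₀ s ε ((le_max_right _ _).trans h)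
  rcases hcond with h | ⟨h, h'⟩ | ⟨rfl, rfl, h⟩
  · refine finish _ ?_ (superlinear_step hm hT hL₁ hL₂ hα hβ hA0 hB0 hA hB h.le)
    have := tendsto_exp_mul_div_rpow_atTop (-(1 - xi - beta * nu)) _ h
    refine this.congr' ?_
    filter_upwards [eventually_gt_atTop 0] with s hs
    rw [Real.rpow_neg hs.le, div_inv_eq_mul, mul_comm]
  · refine finish _ ?_ (superlinear_step hm hT hL₁ hL₂ hα hβ hA0 hB0 hA hB h.ge)
    simpa [h] using tendsto_rpow_atTop h'
  · exact finish _ (tendsto_rpow_atTop h)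
      (superlinear_step_of_two hm hT hL₁ hL₂ hα hβ hA0 hB0 hA hB)

end

/-! ### The Laplacian in an orthonormal basis. -/

section Laplacian

variable {E : Type*} [NormedAddCommGroup E] [InnerProductSpace ℝ E] [FiniteDimensional ℝ E]

theorem laplacian_eq_sum_fderiv {ι : Type*} [Fintype ι] (b : OrthonormalBasis ι ℝ E) {u : E → ℝ}
    (hu : ContDiff ℝ 2 u) (x : E) :
    Laplacian.laplacian u x = ∑ i, fderiv ℝ (fun y => fderiv ℝ u y (b i)) x (b i) := by
  rw [InnerProductSpace.laplacian_eq_iteratedFDeriv_orthonormalBasis u b]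
  refine Finset.sum_congr rfl fun i _ => ?_
  have hd : DifferentiableAt ℝ (fderiv ℝ u) x :=
    (hu.fderiv_right (m := 1) (by norm_num)).differentiable one_ne_zero x
  rw [iteratedFDeriv_two_apply, fderiv_clm_apply hd (differentiableAt_const _)]
  simp

theorem continuous_laplacian {u : E → ℝ} (hu : ContDiff ℝ 2 u) :
    Continuous (Laplacian.laplacian u : E → ℝ) := by
  have h : (Laplacian.laplacian u : E → ℝ) = fun x => ∑ i,
      fderiv ℝ (fun y => fderiv ℝ u y (stdOrthonormalBasis ℝ E i)) x (stdOrthonormalBasis ℝ E i) :=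
    funext (laplacian_eq_sum_fderiv (stdOrthonormalBasis ℝ E) hu)
  rw [h]
  refine continuous_finsetSum _ fun i _ => ?_
  have h1 : ContDiff ℝ 1 fun y => fderiv ℝ u y (stdOrthonormalBasis ℝ E i) :=
    (hu.fderiv_right (m := 1) (by norm_num)).clm_apply contDiff_const
  exact (h1.continuous_fderiv one_ne_zero).clm_apply continuous_const

end Laplacian

/-! ### Spherical integrals, polar coordinates and Green's identity. -/

section SphereIntegral

variable {E : Type*} [NormedAddCommGroup E] [InnerProductSpace ℝ E] [FiniteDimensional ℝ E]
  [MeasurableSpace E] [BorelSpace E] (μ : Measure E) [μ.IsAddHaarMeasure]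

/-- The integral of `ω ↦ f (r ω)` over the unit sphere. -/
noncomputable def sphereIntegral (f : E → ℝ) (r : ℝ) : ℝ :=
  ∫ ω : sphere (0 : E) 1, f (r • (ω : E)) ∂μ.toSphere

/-- The integral over the unit sphere of the radial derivative of `u` at `r ω`. -/
noncomputable def sphereRadialIntegral (u : E → ℝ) (r : ℝ) : ℝ :=
  ∫ ω : sphere (0 : E) 1, fderiv ℝ u (r • (ω : E)) (ω : E) ∂μ.toSphere

theorem continuous_integral_sphere {g : ℝ → sphere (0 : E) 1 → ℝ}
    (hg : Continuous g.uncurry) : Continuous fun r => ∫ ω, g r ω ∂μ.toSphere := by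
  simpa using continuous_parametric_integral_of_continuous (μ := μ.toSphere) hg
    (isCompact_univ : IsCompact (Set.univ : Set (sphere (0 : E) 1)))

theorem continuous_sphereIntegral {f : E → ℝ} (hf : Continuous f) :
    Continuous (sphereIntegral μ f) :=
  continuous_integral_sphere μ (g := fun r ω => f (r • (ω : E))) (by
    simp only [Function.uncurry_def]; fun_prop)

theorem continuous_sphereRadialIntegral {u : E → ℝ} (hu : ContDiff ℝ 1 u) :
    Continuous (sphereRadialIntegral μ u) := by
  have h : Continuous (fderiv ℝ u) := hu.continuous_fderiv one_ne_zero
  exact continuous_integral_sphere μ (g := fun r ω => fderiv ℝ u (r • (ω : E)) (ω : E)) (by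
    simp only [Function.uncurry_def]; fun_prop)

theorem integrable_sphere_of_continuous {g : sphere (0 : E) 1 → ℝ} (hg : Continuous g) :
    Integrable g μ.toSphere :=
  hg.integrable_of_hasCompactSupport (HasCompactSupport.of_compactSpace g)

theorem hasDerivAt_sphereIntegral {u : E → ℝ} (hu : ContDiff ℝ 1 u) (r : ℝ) :
    HasDerivAt (sphereIntegral μ u) (sphereRadialIntegral μ u r) r := by
  have h : Continuous (fderiv ℝ u) := hu.continuous_fderiv one_ne_zero
  obtain ⟨C, hC⟩ := (isCompact_closedBall (0 : E) (|r| + 1)).exists_bound_of_continuousOn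
    h.continuousOn
  refine (hasDerivAt_integral_of_dominated_loc_of_deriv_le (μ := μ.toSphere)
    (F := fun r (ω : sphere (0 : E) 1) => u (r • (ω : E)))
    (F' := fun r (ω : sphere (0 : E) 1) => fderiv ℝ u (r • (ω : E)) (ω : E))
    (bound := fun _ => C) (Metric.ball_mem_nhds r one_pos) ?_ ?_ ?_ ?_ ?_ ?_).2
  · exact .of_forall fun s => Continuous.aestronglyMeasurable (by have := hu.continuous; fun_prop)
  · exact integrable_sphere_of_continuous μ (by have := hu.continuous; fun_prop)
  · exact Continuous.aestronglyMeasurable (by fun_prop)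
  · refine .of_forall fun ω s hs => ?_
    have hω : ‖(ω : E)‖ = 1 := by simp
    have hmem : s • (ω : E) ∈ closedBall (0 : E) (|r| + 1) := by
      rw [mem_closedBall_zero_iff, norm_smul, hω, mul_one, Real.norm_eq_abs]
      rw [Metric.mem_ball, Real.dist_eq] at hs
      have := abs_sub_abs_le_abs_sub s r
      linarith
    calc _ ≤ ‖fderiv ℝ u (s • (ω : E))‖ * ‖(ω : E)‖ := ContinuousLinearMap.le_opNorm _ _
      _ ≤ C := by rw [hω, mul_one]; exact hC _ hmem
  · exact integrable_const _
  · refine .of_forall fun ω s _ => ?_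
    have h1 : HasDerivAt (fun t : ℝ => t • (ω : E)) (ω : E) s := by
      simpa using (hasDerivAt_id s).smul_const (ω : E)
    exact ((hu.differentiable one_ne_zero) (s • (ω : E))).hasFDerivAt.comp_hasDerivAt s h1

/-- Polar coordinates: the origin is a null set, and the measure on its complement is the product of
the sphere measure and `r^{n-1} dr`, where `n` is the dimension. -/
theorem integral_eq_integral_sphereIntegral [Nontrivial E] {f : E → ℝ} (hf : Integrable f μ) :
    ∫ x, f x ∂μ =
      ∫ r in Set.Ioi (0 : ℝ), r ^ (Module.finrank ℝ E - 1) * sphereIntegral μ f r := by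
  have hmp := μ.measurePreserving_homeomorphUnitSphereProd
  have hemb : MeasurableEmbedding (homeomorphUnitSphereProd E) := Homeomorph.measurableEmbedding _
  have hcomp : ∀ x : ({0}ᶜ : Set E), (fun z : sphere (0 : E) 1 × Set.Ioi (0 : ℝ) =>
      f ((z.2 : ℝ) • (z.1 : E))) (homeomorphUnitSphereProd E x) = f x := fun x => by
    have : ‖(x : E)‖ ≠ 0 := norm_ne_zero_iff.2 x.2
    simp [smul_smul, this]
  have hint : Integrable (fun z : sphere (0 : E) 1 × Set.Ioi (0 : ℝ) => f ((z.2 : ℝ) • (z.1 : E)))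
      (μ.toSphere.prod (.volumeIoiPow (Module.finrank ℝ E - 1))) := by
    rw [← hmp.integrable_comp_emb hemb]
    have h1 : Integrable (fun x : ({0}ᶜ : Set E) => f x) (μ.comap (↑)) := by
      have := (integrableOn_iff_comap_subtypeVal (μ := μ) (f := f)
        (measurableSet_singleton (0 : E)).compl).1 hf.integrableOn
      exact this
    exact h1.congr (.of_forall fun x => (hcomp x).symm)
  calc ∫ x, f x ∂μ = ∫ x : ({0}ᶜ : Set E), f x ∂(μ.comap (↑)) := by
        rw [integral_subtype_comap (measurableSet_singleton _).compl f,
          restrict_compl_singleton]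
    _ = ∫ z, f ((z.2 : ℝ) • (z.1 : E))
          ∂(μ.toSphere.prod (.volumeIoiPow (Module.finrank ℝ E - 1))) := by
        rw [← hmp.integral_comp hemb]
        exact integral_congr_ae (.of_forall fun x => (hcomp x).symm)
    _ = ∫ r : Set.Ioi (0 : ℝ), sphereIntegral μ f r
          ∂(.volumeIoiPow (Module.finrank ℝ E - 1)) := integral_prod_symm _ hint
    _ = _ := by
      simp only [Measure.volumeIoiPow, ENNReal.ofReal]
      rw [integral_withDensity_eq_integral_smul,
        integral_subtype_comap measurableSet_Ioi fun a =>
          Real.toNNReal (a ^ (Module.finrank ℝ E - 1)) • sphereIntegral μ f a,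
        setIntegral_congr_fun measurableSet_Ioi fun x hx => ?_]
      · have hx : 0 < x := hx
        simp only [NNReal.smul_def, Real.coe_toNNReal _ (pow_nonneg hx.le _), smul_eq_mul]
      · exact (measurable_subtype_coe.pow_const _).real_toNNReal

/-- Green's identity against a compactly supported radial test function. -/
theorem integral_radial_mul_laplacian {u : E → ℝ} (hu : ContDiff ℝ 2 u) {χ ψ : ℝ → ℝ} {R : ℝ}
    (hχ : ∀ s, HasDerivAt χ (ψ s) s) (hψ : Continuous ψ) (h0 : ∀ s, R ^ 2 ≤ s → χ s = 0)
    (h0' : ∀ s, R ^ 2 ≤ s → ψ s = 0) (hR : 0 ≤ R) :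
    ∫ x, χ (‖x‖ ^ 2) * Laplacian.laplacian u x ∂μ =
      -∫ x, 2 * ψ (‖x‖ ^ 2) * fderiv ℝ u x x ∂μ := by
  have hχc : Continuous χ := continuous_iff_continuousAt.2 fun s => (hχ s).continuousAt
  have hφd : ∀ x : E, HasFDerivAt (fun x : E => χ (‖x‖ ^ 2))
      (ψ (‖x‖ ^ 2) • ((2 : ℝ) • innerSL ℝ x)) x := fun x => by
    have := (hχ (‖x‖ ^ 2)).comp_hasFDerivAt x (hasStrictFDerivAt_norm_sq x).hasFDerivAt
    rw [← ofNat_smul_eq_nsmul ℝ] at this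
    exact this
  have hu1 : Continuous (fderiv ℝ u) := hu.continuous_fderiv two_ne_zero
  have key : ∀ g : ℝ → ℝ, Continuous g → (∀ s, R ^ 2 ≤ s → g s = 0) → ∀ f : E → ℝ, Continuous f →
      Integrable (fun x => g (‖x‖ ^ 2) * f x) μ := by
    intro g hg hg0 f hf
    refine Continuous.integrable_of_hasCompactSupport (by fun_prop)
      (HasCompactSupport.intro (isCompact_closedBall (0 : E) R) fun x hx => ?_)
    have : R ≤ ‖x‖ := by simpa using (not_le.1 (by simpa using hx)).le
    rw [hg0 _ (pow_le_pow_left₀ hR this 2), zero_mul]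
  set b := stdOrthonormalBasis ℝ E
  have hgi : ∀ i, ContDiff ℝ 1 fun y => fderiv ℝ u y (b i) := fun i =>
    (hu.fderiv_right (m := 1) (by norm_num)).clm_apply contDiff_const
  have hgi' : ∀ i, Continuous fun x => fderiv ℝ (fun y => fderiv ℝ u y (b i)) x (b i) := fun i =>
    ((hgi i).continuous_fderiv one_ne_zero).clm_apply continuous_const
  have hi : ∀ i, Integrable (fun x => χ (‖x‖ ^ 2) * fderiv ℝ (fun y => fderiv ℝ u y (b i)) x (b i))
      μ := fun i => key χ hχc h0 _ (hgi' i)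
  have hi' : ∀ i, Integrable (fun x : E => fderiv ℝ (fun x : E => χ (‖x‖ ^ 2)) x (b i) *
      fderiv ℝ u x (b i)) μ := fun i => by
    refine (key ψ hψ h0' (fun x => 2 * inner ℝ x (b i) * fderiv ℝ u x (b i)) (by fun_prop)).congr
      (.of_forall fun x => ?_)
    simp only [(hφd x).fderiv]
    simp [mul_assoc]
  have hibp : ∀ i, ∫ x, χ (‖x‖ ^ 2) * fderiv ℝ (fun y => fderiv ℝ u y (b i)) x (b i) ∂μ =
      -∫ x, fderiv ℝ (fun x : E => χ (‖x‖ ^ 2)) x (b i) * fderiv ℝ u x (b i) ∂μ := fun i =>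
    integral_mul_fderiv_eq_neg_fderiv_mul_of_integrable (hi' i) (hi i)
      (key χ hχc h0 _ (hgi i).continuous) (fun x _ => (hφd x).differentiableAt)
      fun x _ => (hgi i).differentiable one_ne_zero x
  calc ∫ x, χ (‖x‖ ^ 2) * Laplacian.laplacian u x ∂μ
      = ∫ x, ∑ i, χ (‖x‖ ^ 2) * fderiv ℝ (fun y => fderiv ℝ u y (b i)) x (b i) ∂μ := by
        simp_rw [laplacian_eq_sum_fderiv b hu, Finset.mul_sum]
    _ = -∫ x, ∑ i, fderiv ℝ (fun x : E => χ (‖x‖ ^ 2)) x (b i) * fderiv ℝ u x (b i) ∂μ := by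
        rw [integral_finsetSum _ fun i _ => hi i, integral_finsetSum _ fun i _ => hi' i,
          ← Finset.sum_neg_distrib]
        exact Finset.sum_congr rfl fun i _ => hibp i
    _ = _ := by
        congr 2
        ext x
        have h1 : ∑ i, inner ℝ x (b i) * fderiv ℝ u x (b i) = fderiv ℝ u x x := by
          conv_rhs => rw [← b.sum_repr' x, map_sum]
          refine Finset.sum_congr rfl fun i _ => ?_
          rw [map_smul, smul_eq_mul, real_inner_comm, b.sum_repr' x]
        rw [← h1, Finset.mul_sum]
        refine Finset.sum_congr rfl fun i _ => ?_
        rw [(hφd x).fderiv]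
        simp only [smul_apply, innerSL_apply_apply, smul_eq_mul]
        ring

end SphereIntegral

/-! ### The flux of the gradient through spheres. -/

section Flux

variable {E : Type*} [NormedAddCommGroup E] [InnerProductSpace ℝ E] [FiniteDimensional ℝ E]
  [MeasurableSpace E] [BorelSpace E] (μ : Measure E) [μ.IsAddHaarMeasure]

theorem setIntegral_Ioi_eq_intervalIntegral {g : ℝ → ℝ} {R : ℝ} (hR : 0 ≤ R)
    (hg : ∀ r, R ≤ r → g r = 0) : ∫ r in Set.Ioi (0 : ℝ), g r = ∫ r in (0 : ℝ)..R, g r := by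
  rw [intervalIntegral.integral_of_le hR]
  refine (setIntegral_eq_of_subset_of_forall_sdiff_eq_zero measurableSet_Ioi
    Set.Ioc_subset_Ioi_self fun x hx => hg x ?_)
  by_contra h
  exact hx.2 ⟨hx.1, (not_le.1 h).le⟩

/-- The divergence theorem for the gradient of `u` on balls. -/
theorem pow_mul_sphereRadialIntegral [Nontrivial E] {u : E → ℝ} (hu : ContDiff ℝ 2 u) {r : ℝ}
    (hr : 0 < r) :
    r ^ (Module.finrank ℝ E - 1) * sphereRadialIntegral μ u r =
      ∫ s in (0 : ℝ)..r, s ^ (Module.finrank ℝ E - 1) *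
        sphereIntegral μ (Laplacian.laplacian u) s := by
  set n := Module.finrank ℝ E - 1
  have hu1 : ContDiff ℝ 1 u := hu.of_le (by norm_num)
  have hdu : Continuous (fderiv ℝ u) := hu.continuous_fderiv two_ne_zero
  have hLc := continuous_laplacian hu
  have hSc : Continuous fun s => s ^ n * sphereIntegral μ (Laplacian.laplacian u) s :=
    (continuous_pow n).mul (continuous_sphereIntegral μ hLc)
  have hRc := continuous_sphereRadialIntegral μ hu1
  set W : ℝ → ℝ := fun r => r ^ n * sphereRadialIntegral μ u r with hW
  set Z : ℝ → ℝ := fun r => ∫ s in (0 : ℝ)..r, s ^ n *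
    sphereIntegral μ (Laplacian.laplacian u) s with hZ
  have hWc : Continuous W := (continuous_pow n).mul hRc
  have hZd : ∀ r, HasDerivAt Z (r ^ n * sphereIntegral μ (Laplacian.laplacian u) r) r := fun r =>
    hSc.integral_hasStrictDerivAt 0 r |>.hasDerivAt
  have hZc : Continuous Z := continuous_iff_continuousAt.2 fun r => (hZd r).continuousAt
  by_contra hne
  have hD : W r - Z r ≠ 0 := sub_ne_zero.2 hne
  set R := r + 1
  have hR : 0 < R := by positivity
  -- The test function is built from the defect `W - Z` itself, cut off at `R > r`. Green's identity
  -- in polar coordinates and an integration by parts then give `∫ 2s (R - s)(W - Z)² ds = 0` over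
  -- `[0, R]`, which is impossible if the defect is nonzero at `r`.
  set ψ : ℝ → ℝ := fun s => (W √s - Z √s) * max (R - √s) 0 with hψ
  have hψc : Continuous ψ := by fun_prop
  set χ : ℝ → ℝ := fun s => ∫ τ in (R ^ 2)..s, ψ τ with hχ
  have hχd : ∀ s, HasDerivAt χ (ψ s) s := fun s =>
    hψc.integral_hasStrictDerivAt (R ^ 2) s |>.hasDerivAt
  have hχc : Continuous χ := continuous_iff_continuousAt.2 fun s => (hχd s).continuousAt
  have hψ0 : ∀ s, R ^ 2 ≤ s → ψ s = 0 := fun s hs => by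
    have : R ≤ √s := Real.le_sqrt_of_sq_le hs
    simp [hψ, max_eq_right (sub_nonpos.2 this)]
  have hχ0 : ∀ s, R ^ 2 ≤ s → χ s = 0 := fun s hs => by
    rw [hχ]
    simp only
    rw [intervalIntegral.integral_congr (g := fun _ => 0)]
    · simp
    · intro τ hτ
      rw [Set.uIcc_of_le hs] at hτ
      exact hψ0 τ hτ.1
  have hgreen := integral_radial_mul_laplacian μ hu hχd hψc hχ0 hψ0 hR.le
  have hint : ∀ g : ℝ → ℝ, Continuous g → (∀ s, R ^ 2 ≤ s → g s = 0) → ∀ f : E → ℝ,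
      Continuous f → Integrable (fun x => g (‖x‖ ^ 2) * f x) μ := by
    intro g hg hg0 f hf
    refine Continuous.integrable_of_hasCompactSupport (by fun_prop)
      (HasCompactSupport.intro (isCompact_closedBall (0 : E) R) fun x hx => ?_)
    have : R ≤ ‖x‖ := by simpa using (not_le.1 (by simpa using hx)).le
    rw [hg0 _ (pow_le_pow_left₀ hR.le this 2), zero_mul]
  have hnorm : ∀ s : ℝ, ∀ ω : sphere (0 : E) 1, ‖s • (ω : E)‖ ^ 2 = s ^ 2 := fun s ω => by
    simp [norm_smul]
  have hsq : ∀ s, R ≤ s → R ^ 2 ≤ s ^ 2 := fun s hs => pow_le_pow_left₀ hR.le hs 2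
  have hleft : ∫ x, χ (‖x‖ ^ 2) * Laplacian.laplacian u x ∂μ =
      ∫ s in (0 : ℝ)..R, χ (s ^ 2) * (s ^ n * sphereIntegral μ (Laplacian.laplacian u) s) := by
    rw [integral_eq_integral_sphereIntegral μ (hint χ hχc hχ0 _ hLc),
      ← setIntegral_Ioi_eq_intervalIntegral hR.le
        fun s hs => by rw [hχ0 _ (hsq s hs), zero_mul]]
    refine setIntegral_congr_fun measurableSet_Ioi fun s _ => ?_
    simp only [sphereIntegral, hnorm]
    rw [integral_const_mul]; ring
  have hright : ∫ x, 2 * ψ (‖x‖ ^ 2) * fderiv ℝ u x x ∂μ =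
      ∫ s in (0 : ℝ)..R, 2 * s * ψ (s ^ 2) * W s := by
    rw [integral_eq_integral_sphereIntegral μ
      (hint (fun s => 2 * ψ s) (by fun_prop) (fun s hs => by simp [hψ0 s hs]) _ (by fun_prop)),
      ← setIntegral_Ioi_eq_intervalIntegral hR.le
        fun s hs => by rw [hψ0 _ (hsq s hs)]; simp]
    refine setIntegral_congr_fun measurableSet_Ioi fun s _ => ?_
    simp only [sphereIntegral, hnorm, map_smul, smul_eq_mul, hW, sphereRadialIntegral]
    rw [integral_const_mul, integral_const_mul]; ring
  have hparts : ∫ s in (0 : ℝ)..R, (2 * s * ψ (s ^ 2) * Z s +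
      χ (s ^ 2) * (s ^ n * sphereIntegral μ (Laplacian.laplacian u) s)) = 0 := by
    have hd : ∀ s, HasDerivAt (fun s => χ (s ^ 2) * Z s) (2 * s * ψ (s ^ 2) * Z s +
        χ (s ^ 2) * (s ^ n * sphereIntegral μ (Laplacian.laplacian u) s)) s := fun s => by
      have h1 : HasDerivAt (fun s : ℝ => s ^ 2) (2 * s) s := by simpa using hasDerivAt_pow 2 s
      have h2 : HasDerivAt (fun s : ℝ => χ (s ^ 2)) (ψ (s ^ 2) * (2 * s)) s :=
        HasDerivAt.comp (h₂ := χ) s (hχd (s ^ 2)) h1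
      rw [mul_comm (2 * s)]
      exact h2.mul (hZd s)
    rw [intervalIntegral.integral_eq_sub_of_hasDerivAt (fun s _ => hd s)
      (Continuous.intervalIntegrable (by fun_prop) _ _)]
    simp [hχ0 _ le_rfl, hZ]
  have hzero : ∫ s in (0 : ℝ)..R, 2 * s * ψ (s ^ 2) * (W s - Z s) = 0 := by
    rw [intervalIntegral.integral_add (Continuous.intervalIntegrable (by fun_prop) _ _)
      (Continuous.intervalIntegrable (by fun_prop) _ _), ← hleft, hgreen, hright] at hparts
    simp_rw [mul_sub]
    rw [intervalIntegral.integral_sub (Continuous.intervalIntegrable (by fun_prop) _ _)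
      (Continuous.intervalIntegrable (by fun_prop) _ _)]
    linarith
  have hform : ∀ s, 0 ≤ s → 2 * s * ψ (s ^ 2) * (W s - Z s) =
      2 * s * max (R - s) 0 * (W s - Z s) ^ 2 := fun s hs => by
    simp only [hψ, Real.sqrt_sq hs]; ring
  have hpos : 0 < ∫ s in (0 : ℝ)..R, 2 * s * ψ (s ^ 2) * (W s - Z s) := by
    refine intervalIntegral.integral_pos hR (Continuous.continuousOn (by fun_prop))
      (fun s hs => ?_) ⟨r, ⟨hr.le, by simp [R]⟩, ?_⟩
    · rw [hform s hs.1.le]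
      have := hs.1
      positivity
    · rw [hform r hr.le]
      have : max (R - r) 0 = 1 := by simp [R]
      rw [this]
      have := pow_pos (abs_pos.2 hD) 2
      rw [sq_abs] at this
      positivity
  exact hpos.ne' hzero

end Flux

/-! ### Spherical means and the averaged differential inequality. -/

section Average

variable {N : ℕ}

/-- The mean of `f` over the sphere `|x| = r`. -/
noncomputable def sphereMean (f : EuclideanSpace ℝ (Fin N) → ℝ) (r : ℝ) : ℝ :=
  sphereIntegral volume f r / (volume : Measure (EuclideanSpace ℝ (Fin N))).toSphere.real Set.univ

theorem sphereMean_nonneg {f : EuclideanSpace ℝ (Fin N) → ℝ} (hf : ∀ x, 0 ≤ f x) (r : ℝ) :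
    0 ≤ sphereMean f r :=
  div_nonneg (integral_nonneg fun _ => hf _) measureReal_nonneg

theorem toSphere_real_univ_pos (hN : 1 ≤ N) :
    0 < (volume : Measure (EuclideanSpace ℝ (Fin N))).toSphere.real Set.univ := by
  have : Nonempty (Fin N) := ⟨⟨0, hN⟩⟩
  have : NeZero (volume : Measure (EuclideanSpace ℝ (Fin N))).toSphere :=
    ⟨(volume : Measure (EuclideanSpace ℝ (Fin N))).toSphere_ne_zero⟩
  exact measureReal_univ_pos

theorem lintegral_surfaceMeasure_div {f : EuclideanSpace ℝ (Fin N) → ℝ≥0∞}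
    (hf : Measurable f) {r : ℝ} (hr : 0 < r) :
    (∫⁻ x, f x ∂(surfaceMeasure N r)) / (unitSphereArea N * ENNReal.ofReal (r ^ (N - 1))) =
      (∫⁻ ω : sphere (0 : EuclideanSpace ℝ (Fin N)) 1, f (r • (ω : EuclideanSpace ℝ (Fin N)))
        ∂(volume : Measure (EuclideanSpace ℝ (Fin N))).toSphere) / unitSphereArea N := by
  have hr' : 0 < r ^ (N - 1) := by positivity
  rw [surfaceMeasure, lintegral_smul_measure, lintegral_map hf (by fun_prop), smul_eq_mul,
    mul_comm (unitSphereArea N)]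
  exact ENNReal.mul_div_mul_left _ _ (by simpa using hr') ENNReal.ofReal_ne_top

/-- Hölder's inequality with a weight and its dual weight. -/
theorem lintegral_rpow_le_of_weight {X : Type*} [MeasurableSpace X] (σ : Measure X) {α : ℝ}
    (hα : 1 < α) {p v : X → ℝ≥0∞} (hp : Measurable p) (hv : Measurable v) (hp_top : ∀ x, p x ≠ ∞)
    (hI : ∫⁻ x, p x ^ (1 / (1 - α)) ∂σ ≠ ∞) :
    (∫⁻ x, v x ∂σ) ^ α ≤
      (∫⁻ x, p x * v x ^ α ∂σ) * (∫⁻ x, p x ^ (1 / (1 - α)) ∂σ) ^ (α - 1) := by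
  have hα0 : 0 < α := by linarith
  have hα1 : 0 < α - 1 := by linarith
  have hconj : α.HolderConjugate (α / (α - 1)) := Real.HolderConjugate.conjExponent hα
  -- The splitting is `v = (p^{1/α} v) · p^{-1/α}`. It is valid almost everywhere, since finiteness
  -- of the dual integral forces `p ≠ 0` almost everywhere.
  have hH := ENNReal.lintegral_mul_le_Lp_mul_Lq σ hconj
    (f := fun x => p x ^ (1 / α) * v x) (g := fun x => p x ^ (-(1 / α)))
    (by fun_prop) (by fun_prop)
  have hne : ∀ᵐ x ∂σ, p x ≠ 0 := by
    filter_upwards [ae_lt_top (by fun_prop) hI] with x hx h0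
    rw [h0, ENNReal.zero_rpow_of_neg (by rw [one_div]; exact inv_lt_zero.2 (by linarith))] at hx
    exact lt_irrefl _ hx
  have e1 : ∫⁻ x, ((fun x => p x ^ (1 / α) * v x) * fun x => p x ^ (-(1 / α))) x ∂σ =
      ∫⁻ x, v x ∂σ := by
    refine lintegral_congr_ae ?_
    filter_upwards [hne] with x hx
    simp only [Pi.mul_apply]
    rw [mul_right_comm, ← ENNReal.rpow_add _ _ hx (hp_top x)]
    simp
  have e2 : ∀ x, (p x ^ (1 / α) * v x) ^ α = p x * v x ^ α := fun x => by
    rw [ENNReal.mul_rpow_of_nonneg _ _ hα0.le, ← ENNReal.rpow_mul, one_div_mul_cancel hα0.ne',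
      ENNReal.rpow_one]
  have e3 : ∀ x, (p x ^ (-(1 / α))) ^ (α / (α - 1)) = p x ^ (1 / (1 - α)) := fun x => by
    rw [← ENNReal.rpow_mul]
    congr 1
    have : 1 - α ≠ 0 := by linarith
    field_simp
    ring
  rw [e1] at hH
  simp only [e2, e3] at hH
  refine (ENNReal.rpow_le_rpow hH hα0.le).trans_eq ?_
  rw [ENNReal.mul_rpow_of_nonneg _ _ hα0.le, ← ENNReal.rpow_mul, ← ENNReal.rpow_mul,
    one_div_mul_cancel hα0.ne', ENNReal.rpow_one]
  congr 2
  field_simp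

theorem sphericalAverage_mul_le_sphereMean (hN : 1 ≤ N) {α : ℝ} (hα : 1 ≤ α)
    {p v : EuclideanSpace ℝ (Fin N) → ℝ} (hp : Continuous p) (hv : Continuous v)
    (hp0 : ∀ x, 0 ≤ p x) (hv0 : ∀ x, 0 ≤ v x) {r : ℝ} (hr : 0 < r) :
    sphericalAverage α p r * sphereMean v r ^ α ≤ sphereMean (fun x => p x * v x ^ α) r := by
  have hα0 : 0 ≤ α := by linarith
  have hpv0 : ∀ x, 0 ≤ p x * v x ^ α := fun x => mul_nonneg (hp0 x) (Real.rpow_nonneg (hv0 x) _)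
  have hpvc : Continuous fun x => p x * v x ^ α := hp.mul (hv.rpow_const fun x => .inr hα0)
  have hΩ := toSphere_real_univ_pos hN
  set σ := (volume : Measure (EuclideanSpace ℝ (Fin N))).toSphere with hσ
  have hcomp : ∀ f : EuclideanSpace ℝ (Fin N) → ℝ, Continuous f →
      Integrable (fun ω : sphere (0 : EuclideanSpace ℝ (Fin N)) 1 =>
        f (r • (ω : EuclideanSpace ℝ (Fin N)))) σ := fun f hf =>
    integrable_sphere_of_continuous volume (by fun_prop)
  unfold sphericalAverage
  split_ifs with h1
  · rw [lintegral_surfaceMeasure_div (by fun_prop) hr]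
    set I := ∫⁻ ω : sphere (0 : EuclideanSpace ℝ (Fin N)) 1,
      ENNReal.ofReal (p (r • (ω : EuclideanSpace ℝ (Fin N)))) ^ (1 / (1 - α)) ∂σ with hI
    have hA : unitSphereArea N = ENNReal.ofReal (σ.real Set.univ) := by
      rw [unitSphereArea, ofReal_measureReal]
    have hneg : 1 - α < 0 := by linarith
    rcases eq_or_ne I ∞ with htop | htop
    · rw [htop, ENNReal.top_div_of_ne_top (by rw [hA]; exact ENNReal.ofReal_ne_top),
        ENNReal.top_rpow_of_neg hneg, ENNReal.toReal_zero, zero_mul]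
      exact sphereMean_nonneg hpv0 r
    have hH := lintegral_rpow_le_of_weight σ h1
      (p := fun ω => ENNReal.ofReal (p (r • (ω : EuclideanSpace ℝ (Fin N)))))
      (v := fun ω => ENNReal.ofReal (v (r • (ω : EuclideanSpace ℝ (Fin N)))))
      (by fun_prop) (by fun_prop) (fun _ => ENNReal.ofReal_ne_top) htop
    have e : ∀ ω : sphere (0 : EuclideanSpace ℝ (Fin N)) 1,
        ENNReal.ofReal (p (r • (ω : EuclideanSpace ℝ (Fin N)))) *
          ENNReal.ofReal (v (r • (ω : EuclideanSpace ℝ (Fin N)))) ^ α =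
        ENNReal.ofReal ((fun x => p x * v x ^ α) (r • (ω : EuclideanSpace ℝ (Fin N)))) := fun ω => by
      rw [ENNReal.ofReal_rpow_of_nonneg (hv0 _) hα0, ENNReal.ofReal_mul (hp0 _)]
    simp_rw [e] at hH
    rw [← ofReal_integral_eq_lintegral_ofReal (hcomp _ hpvc) (.of_forall fun _ => hpv0 _),
      ← ofReal_integral_eq_lintegral_ofReal (hcomp _ hv) (.of_forall fun _ => hv0 _), ← hI] at hH
    have hx : 0 ≤ sphereIntegral volume v r := integral_nonneg fun _ => hv0 _
    have hy : 0 ≤ sphereIntegral volume (fun x => p x * v x ^ α) r :=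
      integral_nonneg fun _ => hpv0 _
    change ENNReal.ofReal (sphereIntegral volume v r) ^ α ≤
      ENNReal.ofReal (sphereIntegral volume (fun x => p x * v x ^ α) r) * I ^ (α - 1) at hH
    unfold sphereMean
    rw [← hσ]
    set x := sphereIntegral volume v r
    set y := sphereIntegral volume (fun x => p x * v x ^ α) r
    set Ω := σ.real Set.univ
    have hIr : I = ENNReal.ofReal I.toReal := (ENNReal.ofReal_toReal htop).symm
    set i := I.toReal
    have hi0 : 0 ≤ i := ENNReal.toReal_nonneg
    rw [hIr, hA, ← ENNReal.ofReal_div_of_pos hΩ]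
    -- If the integral were zero, its negative power would be `∞`, which `toReal` sends to `0`, so
    -- the bound is trivial.
    rcases hi0.eq_or_lt with h0 | hi
    · rw [← h0, zero_div, ENNReal.ofReal_zero, ENNReal.zero_rpow_of_neg hneg, ENNReal.toReal_top,
        zero_mul]
      positivity
    rw [hIr, ENNReal.ofReal_rpow_of_nonneg hx hα0, ENNReal.ofReal_rpow_of_pos hi,
      ← ENNReal.ofReal_mul hy, ENNReal.ofReal_le_ofReal_iff (by positivity)] at hH
    rw [ENNReal.ofReal_rpow_of_pos (by positivity), ENNReal.toReal_ofReal (by positivity),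
      Real.div_rpow hi.le hΩ.le, Real.div_rpow hx hΩ.le, div_mul_div_comm, ← Real.rpow_add hΩ,
      sub_add_cancel, Real.rpow_one]
    refine div_le_div_of_nonneg_right ?_ hΩ.le
    calc i ^ (1 - α) * x ^ α ≤ i ^ (1 - α) * (y * i ^ (α - 1)) := by gcongr
      _ = y * (i ^ (1 - α) * i ^ (α - 1)) := by ring
      _ = y := by rw [← Real.rpow_add hi]; simp
  · obtain rfl : α = 1 := le_antisymm (not_lt.1 h1) hα
    simp only [Real.rpow_one] at hpvc ⊢
    unfold sphereMean
    rw [← mul_div_assoc]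
    refine div_le_div_of_nonneg_right ?_ hΩ.le
    unfold sphereIntegral
    rw [← integral_const_mul]
    refine integral_mono ((hcomp _ hv).const_mul _) (hcomp _ hpvc) fun ω => ?_
    refine mul_le_mul_of_nonneg_right (csInf_le ⟨0, ?_⟩ ⟨_, ?_, rfl⟩) (hv0 _)
    · rintro _ ⟨x, -, rfl⟩
      exact hp0 x
    · simp [norm_smul, abs_of_pos hr]

theorem exists_sphereMean_pos (hN : 1 ≤ N) {f : EuclideanSpace ℝ (Fin N) → ℝ} (hf : Continuous f)
    (hf0 : ∀ x, 0 ≤ f x) (hne : f ≠ 0) : ∃ t : ℝ, 0 < sphereMean f (Real.exp t) := by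
  have : Nonempty (Fin N) := ⟨⟨0, hN⟩⟩
  -- The radii `e^t` never reach `0`, so a point of positivity away from the origin is needed;
  -- continuity provides one.
  obtain ⟨x, hx0, hx⟩ : ∃ x, x ≠ 0 ∧ 0 < f x := by
    obtain ⟨x, hx⟩ := Function.ne_iff.1 hne
    have hx : 0 < f x := (hf0 x).lt_of_ne' hx
    rcases eq_or_ne x 0 with rfl | h
    · have h1 : ∀ᶠ y in 𝓝[≠] (0 : EuclideanSpace ℝ (Fin N)), 0 < f y :=
        (hf.continuousAt.eventually (lt_mem_nhds hx)).filter_mono nhdsWithin_le_nhds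
      obtain ⟨y, hy, hy0⟩ := (h1.and self_mem_nhdsWithin).exists
      exact ⟨y, hy0, hy⟩
    · exact ⟨x, h, hx⟩
  have hn : 0 < ‖x‖ := norm_pos_iff.2 hx0
  refine ⟨Real.log ‖x‖, div_pos ?_ (toSphere_real_univ_pos hN)⟩
  rw [Real.exp_log hn]
  have hc : Continuous fun ω : sphere (0 : EuclideanSpace ℝ (Fin N)) 1 =>
    f (‖x‖ • (ω : EuclideanSpace ℝ (Fin N))) := by fun_prop
  refine hc.integral_pos_of_hasCompactSupport_nonneg_nonzero (HasCompactSupport.of_compactSpace _)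
    (fun _ => hf0 _) (x := ⟨‖x‖⁻¹ • x, by simp [norm_smul, hn.ne']⟩) ?_
  simp only [smul_smul, mul_inv_cancel₀ hn.ne', one_smul]
  exact hx.ne'

/-- With `r = e^t`, the quantity `e^{(N-2)t} y'` is `r^{N-1}` times the radial derivative of the
mean, hence the flux up to a constant. The flux is nonnegative for every `r` because `Δu ≥ 0`
everywhere, and its `t`-derivative is `e^{(N-2)t} r²` times the mean of `Δu`. -/
theorem isDampedSupersolution_sphereMean (hN : 3 ≤ N) {α lam nu L r₀ T : ℝ} (hα : 1 ≤ α)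
    {p u v : EuclideanSpace ℝ (Fin N) → ℝ} (hp : Continuous p) (hv : Continuous v)
    (hp0 : ∀ x, 0 ≤ p x) (hv0 : ∀ x, 0 ≤ v x) (hu : ContDiff ℝ 2 u)
    (heq : ∀ x, Laplacian.laplacian u x = p x * v x ^ α) (hr₀ : 1 < r₀) (hT : Real.log r₀ ≤ T)
    (hpr : ∀ r, r₀ ≤ r → L / (r ^ lam * Real.log r ^ nu) ≤ sphericalAverage α p r) :
    IsDampedSupersolution (N - 2) T (fun t => sphereMean u (Real.exp t))
      fun t => expWeight L lam nu t * sphereMean v (Real.exp t) ^ α := by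
  have : Nonempty (Fin N) := ⟨⟨0, by omega⟩⟩
  have hΩ := toSphere_real_univ_pos (N := N) (by omega)
  set Ω := (volume : Measure (EuclideanSpace ℝ (Fin N))).toSphere.real Set.univ with hΩdef
  have hLap : (Laplacian.laplacian u : EuclideanSpace ℝ (Fin N) → ℝ) = fun x => p x * v x ^ α :=
    funext heq
  have hSc : Continuous fun s : ℝ => s ^ (N - 1) *
      sphereIntegral volume (Laplacian.laplacian u : EuclideanSpace ℝ (Fin N) → ℝ) s :=
    (continuous_pow _).mul (continuous_sphereIntegral volume (continuous_laplacian hu))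
  have hS0 : ∀ s, 0 ≤ sphereIntegral volume
      (Laplacian.laplacian u : EuclideanSpace ℝ (Fin N) → ℝ) s := fun s => by
    rw [hLap]
    exact integral_nonneg fun _ => mul_nonneg (hp0 _) (Real.rpow_nonneg (hv0 _) _)
  have hflux := fun t : ℝ => pow_mul_sphereRadialIntegral
    (volume : Measure (EuclideanSpace ℝ (Fin N))) hu (Real.exp_pos t)
  rw [finrank_euclideanSpace_fin] at hflux
  have hexp : ∀ t : ℝ, Real.exp ((N - 2 : ℝ) * t) * Real.exp t = Real.exp t ^ (N - 1) := fun t => by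
    rw [← Real.exp_add, ← Real.exp_nat_mul]
    congr 1
    push_cast [Nat.cast_sub (by omega : 1 ≤ N)]
    ring
  refine ⟨fun t => sphereRadialIntegral volume u (Real.exp t) * Real.exp t / Ω,
    fun t => Real.exp t ^ (N - 1) * sphereIntegral volume
      (Laplacian.laplacian u : EuclideanSpace ℝ (Fin N) → ℝ) (Real.exp t) * Real.exp t / Ω,
    fun t => ?_, fun t => ?_, fun t ht => ⟨?_, ?_⟩⟩
  · exact ((hasDerivAt_sphereIntegral volume (hu.of_le (by norm_num)) (Real.exp t)).comp t
      (Real.hasDerivAt_exp t)).div_const Ω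
  · have h1 : 0 ≤ Real.exp t ^ (N - 1) * sphereRadialIntegral volume u (Real.exp t) := by
      rw [hflux t]
      exact intervalIntegral.integral_nonneg (Real.exp_pos t).le fun s hs =>
        mul_nonneg (pow_nonneg hs.1 _) (hS0 s)
    have h2 := nonneg_of_mul_nonneg_right h1 (by positivity)
    positivity
  · have h1 : (fun τ => Real.exp ((N - 2 : ℝ) * τ) *
        (sphereRadialIntegral volume u (Real.exp τ) * Real.exp τ / Ω)) = fun τ =>
        (∫ s in (0 : ℝ)..Real.exp τ, s ^ (N - 1) * sphereIntegral volume
          (Laplacian.laplacian u : EuclideanSpace ℝ (Fin N) → ℝ) s) / Ω := by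
      ext τ
      rw [← hflux τ, ← hexp τ]
      ring
    rw [h1]
    exact ((hSc.integral_hasStrictDerivAt 0 (Real.exp t)).hasDerivAt.comp t
      (Real.hasDerivAt_exp t)).div_const Ω
  · have hre : r₀ ≤ Real.exp t := by
      rw [← Real.log_le_iff_le_exp (by linarith)]
      exact hT.trans ht
    have ht0 : 0 < t := (Real.log_pos hr₀).trans_le (hT.trans ht)
    have h1 := hpr _ hre
    have h2 := sphericalAverage_mul_le_sphereMean (by omega) hα hp hv hp0 hv0 (Real.exp_pos t)
    have h3 : expWeight L lam nu t = Real.exp t * Real.exp t *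
        (L / (Real.exp t ^ lam * Real.log (Real.exp t) ^ nu)) := by
      rw [Real.log_exp, expWeight, Real.rpow_neg ht0.le, ← Real.exp_mul, sub_mul, Real.exp_sub,
        two_mul, Real.exp_add, mul_comm t lam]
      field_simp
    have h4 : Real.exp t ^ (N - 1) * sphereIntegral volume
        (Laplacian.laplacian u : EuclideanSpace ℝ (Fin N) → ℝ) (Real.exp t) * Real.exp t / Ω =
        Real.exp ((N - 2 : ℝ) * t) * (Real.exp t * Real.exp t *
          sphereMean (fun x => p x * v x ^ α) (Real.exp t)) := by
      rw [← hexp t, hLap, sphereMean, ← hΩdef]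
      ring
    beta_reduce
    rw [h4, h3, mul_assoc (Real.exp t * Real.exp t)]
    have hB := Real.rpow_nonneg (sphereMean_nonneg hv0 (Real.exp t)) α
    have h5 := (mul_le_mul_of_nonneg_right h1 hB).trans h2
    gcongr

end Average

/-! ### Conclusion. -/

theorem theorem1 (N : ℕ) (hN : 3 ≤ N) (α β : ℝ) (hα : 1 ≤ α) (hβ : 1 ≤ β) (hαβ : 1 < α * β)
    (p q : EuclideanSpace ℝ (Fin N) → ℝ)
    (hp : Continuous p) (hq : Continuous q) (hp0 : ∀ x, 0 ≤ p x) (hq0 : ∀ x, 0 ≤ q x)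
    (lam mu nu xi L₁ L₂ r₀ : ℝ) (hL₁ : 0 < L₁) (hL₂ : 0 < L₂) (hr₀ : 1 < r₀)
    (hpr : ∀ r : ℝ, r₀ ≤ r → L₁ / (r ^ lam * Real.log r ^ nu) ≤ sphericalAverage α p r)
    (hqr : ∀ r : ℝ, r₀ ≤ r → L₂ / (r ^ mu * Real.log r ^ xi) ≤ sphericalAverage β q r)
    (hcond :
      (0 < 2 - mu + β * (2 - lam)) ∨
      (0 < 2 - lam + α * (2 - mu)) ∨
      (2 - mu + β * (2 - lam) = 0 ∧ lam < 2 ∧ 0 < 1 - xi - β * nu) ∨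
      (2 - lam + α * (2 - mu) = 0 ∧ mu < 2 ∧ 0 < 1 - nu - α * xi) ∨
      (lam = 2 ∧ mu = 2 ∧ 0 < 1 - xi + β * (1 - nu)) ∨
      (lam = 2 ∧ mu = 2 ∧ 0 < 1 - nu + α * (1 - xi))) :
    ¬ ∃ u v : EuclideanSpace ℝ (Fin N) → ℝ,
      IsEntireSolution α β p q u v ∧ (∀ x, 0 ≤ u x) ∧ (∀ x, 0 ≤ v x) ∧ ¬ (u = 0 ∧ v = 0) := by
  rintro ⟨u, v, ⟨hu, hv, hequ, heqv⟩, hu0, hv0, hne⟩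
  have hN' : (3 : ℝ) ≤ N := by exact_mod_cast hN
  -- The starting time `max 1 (log r₀)` ensures both `t ≥ 1` and `e^t ≥ r₀`.
  have hA := isDampedSupersolution_sphereMean hN hα hp hv.continuous hp0 hv0 hu hequ hr₀
    (le_max_right 1 (Real.log r₀)) hpr
  have hB := isDampedSupersolution_sphereMean hN hβ hq hu.continuous hq0 hu0 hv heqv hr₀
    (le_max_right 1 (Real.log r₀)) hqr
  have hA0 := fun t : ℝ => sphereMean_nonneg hu0 (Real.exp t)
  have hB0 := fun t : ℝ => sphereMean_nonneg hv0 (Real.exp t)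
  have hpos : ∃ t, 0 < sphereMean u (Real.exp t) ∨ 0 < sphereMean v (Real.exp t) := by
    by_cases h : u = 0
    · exact (exists_sphereMean_pos (by omega) hv.continuous hv0 fun h' => hne ⟨h, h'⟩).imp
        fun _ => Or.inr
    · exact (exists_sphereMean_pos (by omega) hu.continuous hu0 h).imp fun _ => Or.inl
  have main := false_of_damped_system (by linarith : (0 : ℝ) < N - 2) (le_max_left _ _) hL₁ hL₂
    hα hβ hαβ hA0 hB0 hA hB hpos
  -- Exchanging the two equations turns the conditions on `B` into those on `A`.
  have main' := false_of_damped_system (by linarith : (0 : ℝ) < N - 2) (le_max_left _ _) hL₂ hL₁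
    hβ hα (by linarith) hB0 hA0 hB hA (hpos.imp fun _ => Or.symm)
  rcases hcond with h | h | ⟨h, -, h'⟩ | ⟨h, -, h'⟩ | h | ⟨h, h', h''⟩
  · exact main (.inl h)
  · exact main' (.inl h)
  · exact main (.inr (.inl ⟨h, h'⟩))
  · exact main' (.inr (.inl ⟨h, h'⟩))
  · exact main (.inr (.inr h))
  · exact main' (.inr (.inr ⟨h', h, h''⟩))
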